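/- A sign pattern of order $n$ is an $n\times n$ matrix with entries in $\{0,+,-\}$. For a sign pattern $\mathcal A=[\alpha_{ij}]$, $Q(\mathcal A)$ is the set of real $n\times n$ matrices $A=[a_{ij}]$ such that $a_{ij}$ has sign $\alpha_{ij}$ for all $i,j$; if $A\in Q(\mathcal A)$ we write $\mathcal A=\operatorname{sgn}(A)$. The pattern $\mathcal A$ is spectrally arbitrary if every real monic polynomial of degree $n$ is the characteristic polynomial of some matrix in $Q(\mathcal A)$. A pattern $\mathcal B=[\beta_{ij}]$ is a superpattern of $\mathcal A$ if $\beta_{ij}=\alpha_{ij}$ whenever $\alpha_{ij}\ne 0$. Two patterns are equivalent if one is obtained from the other by any combination of negation, transposition, permutation similarity and signature similarity. Let $$\mathcal T_2=\begin{bmatrix}+&-\\+&-\end{bmatrix}.$$ A pattern $\mathcal B$ of order $3$ is obtained from $\mathcal T_2$ by bordering if there are a nilpotent matrix $A\in Q(\mathcal T_2)$ and vectors $\mathbf x,\mathbf z\in\mathbb R^2$ such that $\mathcal B=\operatorname{sgn}(B)$, where $$B=\begin{bmatrix}I_2&\mathbf 0\\ \mathbf x^T&1\end{bmatrix}\begin{bmatrix}A&\mathbf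 z\\ \mathbf 0^T&0\end{bmatrix}\begin{bmatrix}I_2&\mathbf 0\\ -\mathbf x^T&1\end{bmatrix}=\begin{bmatrix}A-\mathbf z\mathbf x^T&\mathbf z\\ \mathbf x^T(A-\mathbf z\mathbf x^T)&\mathbf x^T\mathbf z\end{bmatrix}.$$ **Corollary.** Every spectrally arbitrary sign pattern of order $3$ is a superpattern of a pattern equivalent to a spectrally arbitrary pattern that is obtained from $\mathcal T_2$ by bordering. -/

import Mathlib

open Polynomial

/-- A sign pattern of order `n`: an `n × n` matrix with entries in `{0, +, -}`
(written `0`, `1`, `-1` in `SignType`). -/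
abbrev SignPattern (n : ℕ) : Type := Matrix (Fin n) (Fin n) SignType

namespace SignPattern

variable {n : ℕ}

/-- The sign pattern `sgn(A)` of a real matrix `A`. -/
noncomputable def sgn (A : Matrix (Fin n) (Fin n) ℝ) : SignPattern n :=
  fun i j => SignType.sign (A i j)

/-- The class `Q(𝒜)` of all real matrices having sign pattern `𝒜` (its realizations). -/
def Q (𝒜 : SignPattern n) : Set (Matrix (Fin n) (Fin n) ℝ) :=
  {A | ∀ i j, SignType.sign (A i j) = 𝒜 i j}

/-- `𝒜` is spectrally arbitrary: every real monic polynomial of degree `n` is the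
characteristic polynomial of some matrix in `Q(𝒜)`. -/
def IsSpectrallyArbitrary (𝒜 : SignPattern n) : Prop :=
  ∀ p : ℝ[X], p.Monic → p.natDegree = n → ∃ A ∈ Q 𝒜, A.charpoly = p

/-- `ℬ` is a superpattern of `𝒜`. -/
def IsSuperpattern (ℬ 𝒜 : SignPattern n) : Prop :=
  ∀ i j, 𝒜 i j ≠ 0 → ℬ i j = 𝒜 i j

/-- `Equivalent 𝒜 ℬ`: the pattern `ℬ` can be obtained from `𝒜` by any combination of negation,
transposition, permutation similarity and signature similarity. -/
inductive Equivalent : SignPattern n → SignPattern n → Prop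
  | refl (𝒜 : SignPattern n) : Equivalent 𝒜 𝒜
  | neg {𝒜 ℬ : SignPattern n} : Equivalent 𝒜 ℬ → Equivalent 𝒜 (-ℬ)
  | transpose {𝒜 ℬ : SignPattern n} : Equivalent 𝒜 ℬ → Equivalent 𝒜 (Matrix.transpose ℬ)
  | perm {𝒜 ℬ : SignPattern n} (σ : Equiv.Perm (Fin n)) :
      Equivalent 𝒜 ℬ → Equivalent 𝒜 (fun i j => ℬ (σ i) (σ j))
  | signature {𝒜 ℬ : SignPattern n} (d : Fin n → SignType) (hd : ∀ i, d i ≠ 0) :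
      Equivalent 𝒜 ℬ → Equivalent 𝒜 (fun i j => d i * ℬ i j * d j)

/-- The pattern `𝒯₂`. -/
def T₂ : SignPattern 2 :=
  !![1, -1;
     1, -1]

/-- The bordered matrix of order `n + 1`,
`[I 0; xᵀ 1] * [A z; 0 0] * [I 0; -xᵀ 1]`. -/
noncomputable def border (A : Matrix (Fin n) (Fin n) ℝ) (x z : Fin n → ℝ) :
    Matrix (Fin (n + 1)) (Fin (n + 1)) ℝ :=
  Matrix.reindex finSumFinEquiv finSumFinEquiv
    (Matrix.fromBlocks 1 0 (Matrix.replicateRow (Fin 1) x) 1 *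
      Matrix.fromBlocks A (Matrix.replicateCol (Fin 1) z) 0 0 *
      Matrix.fromBlocks 1 0 (-Matrix.replicateRow (Fin 1) x) 1)

/-- `ℬ` is obtained from `𝒜` by bordering: it is the sign pattern of a bordered matrix
formed from a nilpotent realization of `𝒜`. -/
def IsBorderingOf (ℬ : SignPattern (n + 1)) (𝒜 : SignPattern n) : Prop :=
  ∃ A ∈ Q 𝒜, IsNilpotent A ∧ ∃ x z : Fin n → ℝ, ℬ = sgn (border A x z)

end SignPattern

/-!
A pattern of order `3` that is spectrally arbitrary has, up to equivalence, one of four patterns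
`pathPattern`, `cyclePattern`, `mixedPattern`, `starPattern` as a subpattern. Each of these four is
spectrally arbitrary, because a single large parameter `k` lets one prescribe explicitly all the
coefficients of the characteristic polynomial, and each is the sign pattern of an explicit border
of a nilpotent realization of `T₂`.

To find one of the four inside `𝒮`, normalize the diagonal to `(+, e, -)` with `e ∈ {0, +}`: a
realization of positive and one of negative trace show that both signs occur on the diagonal, and
negation and permutation do the rest. What remains depends only on the signs of the
cycle products `𝒮 i j * 𝒮 j i` and `𝒮 i j * 𝒮 j k * 𝒮 k i`, since signature similarity can adjust
everything else. Four facts constrain these five signs: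

* the product of the two `3`-cycles is the product of the three `2`-cycles;
* some `2`-cycle is negative, because a nilpotent `A` satisfies `tr (A ^ 2) = 0`;
* both signs occur among the terms of the determinant, because it takes both signs (for `e = +`
  only the positive one is a constraint, the product of the diagonal being negative);
* for `e = +` the `2`-cycles and `3`-cycles do not all have the signs for which the coefficients of
  the characteristic polynomial cannot vanish simultaneously (`false_of_cycle_signs`).

The finite check `cycle_signs_of_zero`, `cycle_signs_of_pos` says that any five signs meeting these
constraints exhibit one of the four patterns, possibly after transposition, negation or a
permutation of the indices (`hasBorderedSubpattern_of_cycles`,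
`hasBorderedSubpattern_of_neg_star`).
-/

namespace SignPattern

open Matrix

/-! ### Spectral arbitrariness in terms of coefficients -/

/-- The sum of the principal minors of order two. -/
def minorSum (A : Matrix (Fin 3) (Fin 3) ℝ) : ℝ :=
  A 0 0 * A 1 1 - A 0 1 * A 1 0 + (A 0 0 * A 2 2 - A 0 2 * A 2 0)
    + (A 1 1 * A 2 2 - A 1 2 * A 2 1)

lemma charpoly_fin_three (A : Matrix (Fin 3) (Fin 3) ℝ) :
    A.charpoly = X ^ 3 - C A.trace * X ^ 2 + C (minorSum A) * X - C A.det := by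
  rw [charpoly, det_fin_three]
  simp [trace_fin_three, det_fin_three, minorSum]
  ring

lemma monic_cubic (a b c : ℝ) :
    (X ^ 3 - C a * X ^ 2 + C b * X - C c : ℝ[X]).Monic := by
  monicity!

lemma natDegree_cubic (a b c : ℝ) :
    (X ^ 3 - C a * X ^ 2 + C b * X - C c : ℝ[X]).natDegree = 3 := by
  compute_degree!

lemma isSpectrallyArbitrary_iff {𝒮 : SignPattern 3} :
    𝒮.IsSpectrallyArbitrary ↔
      ∀ t s d : ℝ, ∃ A ∈ 𝒮.Q, A.trace = t ∧ minorSum A = s ∧ A.det = d := by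
  constructor
  · intro h t s d
    obtain ⟨A, hA, hp⟩ := h _ (monic_cubic t s d) (natDegree_cubic t s d)
    rw [charpoly_fin_three] at hp
    refine ⟨A, hA, ?_, ?_, ?_⟩
    · simpa [coeff_X, coeff_C] using congrArg (fun p => coeff p 2) hp
    · simpa [coeff_X, coeff_C] using congrArg (fun p => coeff p 1) hp
    · simpa [coeff_X, coeff_C] using congrArg (fun p => coeff p 0) hp
  · intro h p hm hd
    obtain ⟨A, hA, ht, hs, hdet⟩ := h (-p.coeff 2) (p.coeff 1) (-p.coeff 0)
    refine ⟨A, hA, ?_⟩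
    have h3 : p.coeff 3 = 1 := by rw [← hd]; exact hm
    rw [charpoly_fin_three, ht, hs, hdet, p.as_sum_range_C_mul_X_pow, hd]
    simp [Finset.sum_range_succ, h3]
    ring

lemma IsSpectrallyArbitrary.neg {𝒮 : SignPattern 3} (h : 𝒮.IsSpectrallyArbitrary) :
    (-𝒮).IsSpectrallyArbitrary := by
  rw [isSpectrallyArbitrary_iff] at h ⊢
  intro t s d
  obtain ⟨A, hA, ht, hs, hd⟩ := h (-t) s (-d)
  refine ⟨-A, fun i j => ?_, ?_, ?_, ?_⟩
  · simp [Left.sign_neg, hA i j]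
  · simp [ht]
  · simpa [minorSum] using hs
  · simp [det_neg, hd]; ring

lemma IsSpectrallyArbitrary.perm {n : ℕ} {𝒮 : SignPattern n} (h : 𝒮.IsSpectrallyArbitrary)
    (σ : Equiv.Perm (Fin n)) :
    IsSpectrallyArbitrary (fun i j => 𝒮 (σ i) (σ j)) := by
  intro p hm hd
  obtain ⟨A, hA, hp⟩ := h p hm hd
  exact ⟨reindex σ.symm σ.symm A, fun i j => hA _ _, by rw [charpoly_reindex, hp]⟩

/-! ### The conclusion is invariant under equivalence -/

/-- `𝒮` is a superpattern of a pattern equivalent to a spectrally arbitrary bordering of `T₂`. -/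
def HasBorderedSubpattern (𝒮 : SignPattern 3) : Prop :=
  ∃ ℬ ℬ' : SignPattern 3, IsBorderingOf ℬ T₂ ∧ IsSpectrallyArbitrary ℬ ∧
    Equivalent ℬ ℬ' ∧ IsSuperpattern 𝒮 ℬ'

namespace HasBorderedSubpattern

variable {𝒮 : SignPattern 3}

lemma of_neg (h : HasBorderedSubpattern (-𝒮)) : HasBorderedSubpattern 𝒮 := by
  obtain ⟨ℬ, ℬ', hb, hs, he, hsup⟩ := h
  refine ⟨ℬ, -ℬ', hb, hs, he.neg, fun i j hij => ?_⟩
  have := hsup i j (by simpa [SignType.neg_eq_zero_iff] using hij)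
  simp [← this]

lemma of_transpose (h : HasBorderedSubpattern 𝒮ᵀ) : HasBorderedSubpattern 𝒮 := by
  obtain ⟨ℬ, ℬ', hb, hs, he, hsup⟩ := h
  exact ⟨ℬ, ℬ'ᵀ, hb, hs, he.transpose, fun i j hij => hsup j i hij⟩

lemma of_perm (σ : Equiv.Perm (Fin 3))
    (h : HasBorderedSubpattern (fun i j => 𝒮 (σ i) (σ j))) : HasBorderedSubpattern 𝒮 := by
  obtain ⟨ℬ, ℬ', hb, hs, he, hsup⟩ := h
  refine ⟨ℬ, _, hb, hs, he.perm σ.symm, fun i j hij => ?_⟩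
  simpa using hsup _ _ hij

end HasBorderedSubpattern

/-! ### Four spectrally arbitrary borderings -/

/-- The pattern whose digraph is a path with two negative `2`-cycles, ending in loops of opposite
sign. -/
def pathPattern : SignPattern 3 := !![1, -1, 0; 1, 0, -1; 0, 1, -1]

/-- The pattern whose digraph has a negative `2`-cycle and a positive `3`-cycle. -/
def cyclePattern : SignPattern 3 := !![1, -1, 0; 1, 0, -1; 1, 0, -1]

/-- The pattern whose digraph has a positive and a negative `2`-cycle and a negative `3`-cycle. -/
def mixedPattern : SignPattern 3 := !![1, 1, -1; 1, 0, -1; 1, 0, -1]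

/-- The pattern whose digraph is a star with a positive and a negative `2`-cycle, the loops at the
leaves having the sign opposite to that at the centre. -/
def starPattern : SignPattern 3 := !![1, -1, 1; 1, -1, 0; 1, 0, -1]

/-- If the parameter `k` is large, the coefficients `t`, `s`, `d` do not affect the signs of the
entries solved for. -/
lemma exists_large_parameter (t s d : ℝ) :
    ∃ k : ℝ, 0 < k ∧ 0 < t + k ∧ 0 < k - d ∧ 0 < s + t * k + k ^ 2 ∧
      |d| < k * (s + t * k + k ^ 2) ∧ |d| < (t + k) * (s + t * k + k ^ 2) := by
  have ht := abs_nonneg t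
  have hs := abs_nonneg s
  have hd := abs_nonneg d
  set k := 1 + |t| + |s| + |d| with hk
  have hk1 : 1 ≤ k := by linarith
  have htk := neg_abs_le t
  have hsk := neg_abs_le s
  have h1 : 1 + |d| ≤ s + t * k + k ^ 2 := by
    have h2 : k * (1 + |s| + |d|) ≤ k * (t + k) := by
      apply mul_le_mul_of_nonneg_left _ (by linarith); linarith
    have h3 : 1 + |s| + |d| ≤ k * (1 + |s| + |d|) := le_mul_of_one_le_left (by positivity) hk1
    nlinarith
  refine ⟨k, by linarith, by linarith, ?_, by linarith, ?_, ?_⟩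
  · linarith [le_abs_self d]
  · linarith [le_mul_of_one_le_left (a := k) (b := s + t * k + k ^ 2) (by linarith) hk1]
  · linarith [le_mul_of_one_le_left (a := t + k) (b := s + t * k + k ^ 2) (by linarith)
      (by linarith)]

lemma mem_Q_of_fin_three {𝒮 : SignPattern 3} {A : Matrix (Fin 3) (Fin 3) ℝ}
    (h0 : SignType.sign (A 0 0) = 𝒮 0 0 ∧ SignType.sign (A 0 1) = 𝒮 0 1 ∧
      SignType.sign (A 0 2) = 𝒮 0 2)
    (h1 : SignType.sign (A 1 0) = 𝒮 1 0 ∧ SignType.sign (A 1 1) = 𝒮 1 1 ∧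
      SignType.sign (A 1 2) = 𝒮 1 2)
    (h2 : SignType.sign (A 2 0) = 𝒮 2 0 ∧ SignType.sign (A 2 1) = 𝒮 2 1 ∧
      SignType.sign (A 2 2) = 𝒮 2 2) : A ∈ 𝒮.Q := by
  intro i j
  fin_cases i <;> fin_cases j <;> tauto

lemma pathPattern_isSpectrallyArbitrary : pathPattern.IsSpectrallyArbitrary := by
  rw [isSpectrallyArbitrary_iff]
  intro t s d
  obtain ⟨k, hk, htk, -, -, hd, hd'⟩ := exists_large_parameter t s d
  -- The entries `b`, `c` below the diagonal solve `b + c = S` and `(t + k) * c - k * b = d`.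
  set S := s + t * k + k ^ 2 with hS
  have hb : 0 < ((t + k) * S - d) / (t + k + k) :=
    div_pos (by linarith [le_abs_self d]) (by linarith)
  have hc : 0 < (d + k * S) / (t + k + k) :=
    div_pos (by linarith [neg_abs_le d]) (by linarith)
  have hsum : ((t + k) * S - d) / (t + k + k) + (d + k * S) / (t + k + k) = S := by
    field_simp
    ring
  have hdet : (t + k) * ((d + k * S) / (t + k + k)) - k * (((t + k) * S - d) / (t + k + k)) = d := by
    field_simp
    ring
  generalize ((t + k) * S - d) / (t + k + k) = b at *
  generalize (d + k * S) / (t + k + k) = c at *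
  refine ⟨!![t + k, -1, 0; b, 0, -1; 0, c, -k], mem_Q_of_fin_three ?_ ?_ ?_, ?_, ?_, ?_⟩
  · simp [pathPattern, htk]
  · simp [pathPattern, hb]
  · simp [pathPattern, hc, hk]
  · simp [trace_fin_three]
  · simp [minorSum]; linarith
  · simp [det_fin_three]; linarith

lemma cyclePattern_isSpectrallyArbitrary : cyclePattern.IsSpectrallyArbitrary := by
  rw [isSpectrallyArbitrary_iff]
  intro t s d
  obtain ⟨k, hk, htk, -, hS, hd, -⟩ := exists_large_parameter t s d
  have hc : 0 < d + k * (s + t * k + k ^ 2) := by linarith [neg_abs_le d]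
  refine ⟨!![t + k, -1, 0; s + t * k + k ^ 2, 0, -1; d + k * (s + t * k + k ^ 2), 0, -k],
    mem_Q_of_fin_three ?_ ?_ ?_, ?_, ?_, ?_⟩
  · simp [cyclePattern, htk]
  · simp [cyclePattern, hS]
  · simp [cyclePattern, hc, hk]
  · simp [trace_fin_three]
  · simp [minorSum]; ring
  · simp [det_fin_three]; ring

lemma mixedPattern_isSpectrallyArbitrary : mixedPattern.IsSpectrallyArbitrary := by
  rw [isSpectrallyArbitrary_iff]
  intro t s d
  obtain ⟨k, hk, htk, hkd, hS, -, -⟩ := exists_large_parameter t s d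
  have hc : 0 < (s + t * k + k ^ 2 + 1) / (k - d) := by positivity
  refine ⟨!![t + k, 1, -((s + t * k + k ^ 2 + 1) / (k - d)); 1, 0, -1; k - d, 0, -k],
    mem_Q_of_fin_three ?_ ?_ ?_, ?_, ?_, ?_⟩
  · simp [mixedPattern, htk, hc]
  · simp [mixedPattern]
  · simp only [mixedPattern]; simp [hk, sub_pos.mp hkd]
  · simp [trace_fin_three]
  · simp [minorSum]; field_simp; ring
  · simp [det_fin_three]

lemma starPattern_isSpectrallyArbitrary : starPattern.IsSpectrallyArbitrary := by
  rw [isSpectrallyArbitrary_iff]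
  intro t s d
  obtain ⟨k, hk, htk, -, hS, hd, -⟩ := exists_large_parameter t s d
  -- With leaf loops `-2 * k` and `-k`, the trace forces the central loop `t + 3 * k`, and the
  -- other two coefficients are linear equations for `b`, `c` with positive solutions.
  have hc : 0 < (k * (s + t * k + k ^ 2) + d) / k := div_pos (by linarith [neg_abs_le d]) hk
  have hkc : k * ((k * (s + t * k + k ^ 2) + d) / k) = k * (s + t * k + k ^ 2) + d := by
    field_simp
  generalize (k * (s + t * k + k ^ 2) + d) / k = c at *
  have ha : 0 < t + 3 * k := by linarith
  have hb : 0 < c + (s + 3 * k * (t + 3 * k) - 2 * k ^ 2) := by nlinarith [mul_pos hk htk]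
  refine ⟨!![t + 3 * k, -1, 1; c + (s + 3 * k * (t + 3 * k) - 2 * k ^ 2), -(2 * k), 0; c, 0, -k],
    mem_Q_of_fin_three ?_ ?_ ?_, ?_, ?_, ?_⟩
  · simp [starPattern, ha]
  · simp only [starPattern]; simp [hb, hk]
  · simp [starPattern, hc, hk]
  · simp [trace_fin_three]; ring
  · simp [minorSum]; ring
  · simp [det_fin_three]; linarith

lemma border_fin_two (A : Matrix (Fin 2) (Fin 2) ℝ) (x z : Fin 2 → ℝ) :
    border A x z =
      !![A 0 0 - z 0 * x 0, A 0 1 - z 0 * x 1, z 0;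
        A 1 0 - z 1 * x 0, A 1 1 - z 1 * x 1, z 1;
        x 0 * (A 0 0 - z 0 * x 0) + x 1 * (A 1 0 - z 1 * x 0),
        x 0 * (A 0 1 - z 0 * x 1) + x 1 * (A 1 1 - z 1 * x 1),
        x 0 * z 0 + x 1 * z 1] := by
  have h0 : (finSumFinEquiv (m := 2) (n := 1)).symm 0 = Sum.inl 0 := by decide
  have h1 : (finSumFinEquiv (m := 2) (n := 1)).symm 1 = Sum.inl 1 := by decide
  have h2 : (finSumFinEquiv (m := 2) (n := 1)).symm 2 = Sum.inr 0 := by decide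
  ext i j
  fin_cases i <;> fin_cases j <;>
    simp [border, fromBlocks_multiply, h0, h1, h2, mul_apply, Fin.sum_univ_two] <;> ring

lemma isBorderingOf_T₂ {ℬ : SignPattern 3} (a b c d : ℝ) (x z : Fin 2 → ℝ)
    (ha : 0 < a) (hb : b < 0) (hc : 0 < c) (hd : d < 0) (htr : d = -a) (hdet : b * c = -a ^ 2)
    (h : !![a - z 0 * x 0, b - z 0 * x 1, z 0;
      c - z 1 * x 0, d - z 1 * x 1, z 1;
      x 0 * (a - z 0 * x 0) + x 1 * (c - z 1 * x 0),
      x 0 * (b - z 0 * x 1) + x 1 * (d - z 1 * x 1),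
      x 0 * z 0 + x 1 * z 1] ∈ ℬ.Q) : IsBorderingOf ℬ T₂ := by
  refine ⟨!![a, b; c, d], ?_, ⟨2, ?_⟩, x, z, ?_⟩
  · intro i j
    fin_cases i <;> fin_cases j <;> simp [T₂, ha, hb, hc, hd]
  · rw [pow_two, htr]
    ext i j
    fin_cases i <;> fin_cases j <;> simp [mul_apply, Fin.sum_univ_two] <;> linarith
  · rw [border_fin_two]
    ext i j
    exact (h i j).symm

lemma pathPattern_isBorderingOf : IsBorderingOf pathPattern T₂ := by
  refine isBorderingOf_T₂ 1 (-1) 1 (-1) ![-1 / 2, 1] ![0, -1] (by norm_num) (by norm_num)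
    (by norm_num) (by norm_num) (by norm_num) (by norm_num) ?_
  apply mem_Q_of_fin_three <;> simp [pathPattern] <;> norm_num

lemma cyclePattern_isBorderingOf : IsBorderingOf cyclePattern T₂ := by
  refine isBorderingOf_T₂ 1 (-1) 1 (-1) ![0, 1] ![0, -1] (by norm_num) (by norm_num)
    (by norm_num) (by norm_num) (by norm_num) (by norm_num) ?_
  apply mem_Q_of_fin_three <;> simp [cyclePattern]

lemma mixedPattern_isBorderingOf : IsBorderingOf mixedPattern T₂ := by
  refine isBorderingOf_T₂ 1 (-1) 1 (-1) ![0, 1] ![-2, -1] (by norm_num) (by norm_num)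
    (by norm_num) (by norm_num) (by norm_num) (by norm_num) ?_
  apply mem_Q_of_fin_three <;> simp [mixedPattern]

lemma starPattern_isBorderingOf : IsBorderingOf starPattern T₂ := by
  refine isBorderingOf_T₂ 2 (-1 / 2) 8 (-2) ![-1, 1 / 2] ![1, 0] (by norm_num) (by norm_num)
    (by norm_num) (by norm_num) (by norm_num) (by norm_num) ?_
  apply mem_Q_of_fin_three <;> simp [starPattern] <;> norm_num

/-! ### Recognizing the four patterns from cycle products -/

/-- The signature similarity with diagonal `(1, d₁, d₂)` carries `ℬ` to a subpattern of `𝒮`. The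
lemmas below read off `d₁`, `d₂` from a spanning tree of the digraph of `ℬ`, and the cycle products
then determine the remaining entries. -/
lemma hasBorderedSubpattern_of_signature {𝒮 ℬ : SignPattern 3} (hb : IsBorderingOf ℬ T₂)
    (hs : ℬ.IsSpectrallyArbitrary) (d₁ d₂ : SignType) (h₁ : d₁ ≠ 0) (h₂ : d₂ ≠ 0)
    (h : ∀ i j, ℬ i j ≠ 0 → 𝒮 i j = ![1, d₁, d₂] i * ℬ i j * ![1, d₁, d₂] j) :
    HasBorderedSubpattern 𝒮 := by
  refine ⟨ℬ, _, hb, hs, (Equivalent.refl ℬ).signature ![1, d₁, d₂] ?_, fun i j hij => h i j ?_⟩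
  · intro i
    fin_cases i <;> simp [h₁, h₂]
  · intro h0
    simp [h0] at hij

variable {𝒮 : SignPattern 3}

lemma hasBorderedSubpattern_of_path (h0 : 𝒮 0 0 = 1) (h2 : 𝒮 2 2 = -1)
    (h01 : 𝒮 0 1 * 𝒮 1 0 = -1) (h12 : 𝒮 1 2 * 𝒮 2 1 = -1) : HasBorderedSubpattern 𝒮 := by
  refine hasBorderedSubpattern_of_signature pathPattern_isBorderingOf
    pathPattern_isSpectrallyArbitrary (𝒮 1 0) (-(𝒮 1 0 * 𝒮 1 2)) ?_ ?_ fun i j => ?_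
  on_goal 3 => fin_cases i <;> fin_cases j <;> simp [pathPattern, h0, h2]
  all_goals
    clear h0 h2
    generalize 𝒮 0 1 = a, 𝒮 1 0 = b, 𝒮 1 2 = c, 𝒮 2 1 = d at *
    decide +revert

lemma hasBorderedSubpattern_of_cycle (h0 : 𝒮 0 0 = 1) (h2 : 𝒮 2 2 = -1)
    (h01 : 𝒮 0 1 * 𝒮 1 0 = -1) (h012 : 𝒮 0 1 * 𝒮 1 2 * 𝒮 2 0 = 1) :
    HasBorderedSubpattern 𝒮 := by
  refine hasBorderedSubpattern_of_signature cyclePattern_isBorderingOf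
    cyclePattern_isSpectrallyArbitrary (𝒮 1 0) (𝒮 2 0) ?_ ?_ fun i j => ?_
  on_goal 3 => fin_cases i <;> fin_cases j <;> simp [cyclePattern, h0, h2]
  all_goals
    clear h0 h2
    generalize 𝒮 0 1 = a, 𝒮 1 0 = b, 𝒮 1 2 = c, 𝒮 2 0 = d at *
    decide +revert

lemma hasBorderedSubpattern_of_mixed (h0 : 𝒮 0 0 = 1) (h2 : 𝒮 2 2 = -1)
    (h01 : 𝒮 0 1 * 𝒮 1 0 = 1) (h02 : 𝒮 0 2 * 𝒮 2 0 = -1)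
    (h012 : 𝒮 0 1 * 𝒮 1 2 * 𝒮 2 0 = -1) : HasBorderedSubpattern 𝒮 := by
  refine hasBorderedSubpattern_of_signature mixedPattern_isBorderingOf
    mixedPattern_isSpectrallyArbitrary (𝒮 1 0) (𝒮 2 0) ?_ ?_ fun i j => ?_
  on_goal 3 => fin_cases i <;> fin_cases j <;> simp [mixedPattern, h0, h2]
  all_goals
    clear h0 h2
    generalize 𝒮 0 1 = a, 𝒮 1 0 = b, 𝒮 1 2 = c, 𝒮 2 0 = d, 𝒮 0 2 = e at *
    decide +revert

lemma hasBorderedSubpattern_of_star (h0 : 𝒮 0 0 = 1) (h1 : 𝒮 1 1 = -1) (h2 : 𝒮 2 2 = -1)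
    (h01 : 𝒮 0 1 * 𝒮 1 0 = -1) (h02 : 𝒮 0 2 * 𝒮 2 0 = 1) : HasBorderedSubpattern 𝒮 := by
  refine hasBorderedSubpattern_of_signature starPattern_isBorderingOf
    starPattern_isSpectrallyArbitrary (𝒮 1 0) (𝒮 2 0) ?_ ?_ fun i j => ?_
  on_goal 3 => fin_cases i <;> fin_cases j <;> simp [starPattern, h0, h1, h2]
  all_goals
    clear h0 h1 h2
    generalize 𝒮 0 1 = a, 𝒮 1 0 = b, 𝒮 2 0 = c, 𝒮 0 2 = d at *
    decide +revert

/-- The sign of the `2`-cycle through `i` and `j`. -/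
def cycle₂ (𝒮 : SignPattern 3) (i j : Fin 3) : SignType := 𝒮 i j * 𝒮 j i

/-- The sign of the `3`-cycle `i → j → k → i`. -/
def cycle₃ (𝒮 : SignPattern 3) (i j k : Fin 3) : SignType := 𝒮 i j * 𝒮 j k * 𝒮 k i

lemma cycle₂_comm (i j : Fin 3) : cycle₂ 𝒮 i j = cycle₂ 𝒮 j i := mul_comm _ _

lemma cycle₃_rotate (i j k : Fin 3) : cycle₃ 𝒮 i j k = cycle₃ 𝒮 j k i := by
  simp only [cycle₃]
  ac_rfl

lemma cycle₂_transpose (i j : Fin 3) : cycle₂ 𝒮ᵀ i j = cycle₂ 𝒮 i j := mul_comm _ _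

lemma cycle₃_transpose (i j k : Fin 3) : cycle₃ 𝒮ᵀ i j k = cycle₃ 𝒮 i k j := by
  simp only [cycle₃, transpose_apply]
  ac_rfl

lemma cycle₂_neg (i j : Fin 3) : cycle₂ (-𝒮) i j = cycle₂ 𝒮 i j := by simp [cycle₂]

lemma cycle₃_neg (i j k : Fin 3) : cycle₃ (-𝒮) i j k = -cycle₃ 𝒮 i j k := by simp [cycle₃]

/-- Both `3`-cycles together traverse each of the three `2`-cycles once. -/
lemma cycle₃_mul_cycle₃ (i j k : Fin 3) :
    cycle₃ 𝒮 i j k * cycle₃ 𝒮 i k j = cycle₂ 𝒮 i j * cycle₂ 𝒮 j k * cycle₂ 𝒮 i k := by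
  simp only [cycle₂, cycle₃]
  ac_rfl

lemma exists_perm_eq : ∀ i j k : Fin 3, i ≠ j → j ≠ k → i ≠ k →
    ∃ σ : Equiv.Perm (Fin 3), σ 0 = i ∧ σ 1 = j ∧ σ 2 = k := by
  decide

/-- Signs of the cycle products at a loop `i` of sign `+`, a loop `k` of sign `-` and the third
index `j` that yield `pathPattern`, `cyclePattern` or `mixedPattern`. -/
def IsForcing (ij jk ik ijk : SignType) : Prop :=
  ij = -1 ∧ jk = -1 ∨ ij = -1 ∧ ijk = 1 ∨ ij = 1 ∧ ik = -1 ∧ ijk = -1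

instance (ij jk ik ijk : SignType) : Decidable (IsForcing ij jk ik ijk) := by
  unfold IsForcing
  infer_instance

lemma hasBorderedSubpattern_of_isForcing {i j k : Fin 3} (hij : i ≠ j) (hjk : j ≠ k)
    (hik : i ≠ k) (hi : 𝒮 i i = 1) (hk : 𝒮 k k = -1)
    (h : IsForcing (cycle₂ 𝒮 i j) (cycle₂ 𝒮 j k) (cycle₂ 𝒮 i k) (cycle₃ 𝒮 i j k)) :
    HasBorderedSubpattern 𝒮 := by
  obtain ⟨σ, rfl, rfl, rfl⟩ := exists_perm_eq i j k hij hjk hik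
  apply HasBorderedSubpattern.of_perm σ
  rcases h with ⟨h1, h2⟩ | ⟨h1, h2⟩ | ⟨h1, h2, h3⟩
  · exact hasBorderedSubpattern_of_path hi hk h1 h2
  · exact hasBorderedSubpattern_of_cycle hi hk h1 h2
  · exact hasBorderedSubpattern_of_mixed hi hk h1 h2 h3

/-- The condition `IsForcing`, closed under transposition (which exchanges the `3`-cycles `q`, `r`)
and under negation followed by exchange of `i` and `k` (which also negates the `3`-cycles). -/
def IsForcingUpToSymmetry (ij jk ik q r : SignType) : Prop :=
  IsForcing ij jk ik q ∨ IsForcing ij jk ik r ∨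
    IsForcing jk ij ik (-q) ∨ IsForcing jk ij ik (-r)

instance (ij jk ik q r : SignType) : Decidable (IsForcingUpToSymmetry ij jk ik q r) := by
  unfold IsForcingUpToSymmetry
  infer_instance

lemma hasBorderedSubpattern_of_cycles {i j k : Fin 3} (hij : i ≠ j) (hjk : j ≠ k)
    (hik : i ≠ k) (hi : 𝒮 i i = 1) (hk : 𝒮 k k = -1)
    (h : IsForcingUpToSymmetry (cycle₂ 𝒮 i j) (cycle₂ 𝒮 j k) (cycle₂ 𝒮 i k)
      (cycle₃ 𝒮 i j k) (cycle₃ 𝒮 i k j)) :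
    HasBorderedSubpattern 𝒮 := by
  rcases h with h | h | h | h
  · exact hasBorderedSubpattern_of_isForcing hij hjk hik hi hk h
  · apply HasBorderedSubpattern.of_transpose
    apply hasBorderedSubpattern_of_isForcing hij hjk hik (by simpa using hi) (by simpa using hk)
    simpa only [cycle₂_transpose, cycle₃_transpose] using h
  · apply HasBorderedSubpattern.of_neg
    apply HasBorderedSubpattern.of_transpose
    apply hasBorderedSubpattern_of_isForcing hjk.symm hij.symm hik.symm (by simp [hk])
      (by simp [hi])
    rw [cycle₂_transpose, cycle₂_transpose, cycle₂_transpose, cycle₃_transpose, cycle₂_neg,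
      cycle₂_neg, cycle₂_neg, cycle₃_neg, cycle₂_comm k j, cycle₂_comm j i, cycle₂_comm k i,
      cycle₃_rotate k i j]
    exact h
  · apply HasBorderedSubpattern.of_neg
    apply hasBorderedSubpattern_of_isForcing hjk.symm hij.symm hik.symm (by simp [hk])
      (by simp [hi])
    rw [cycle₂_neg, cycle₂_neg, cycle₂_neg, cycle₃_neg, cycle₂_comm k j, cycle₂_comm j i,
      cycle₂_comm k i, ← cycle₃_rotate i k j]
    exact h

/-- The negative of `starPattern`, with centre `k`. -/
lemma hasBorderedSubpattern_of_neg_star {i j k : Fin 3} (hij : i ≠ j) (hjk : j ≠ k)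
    (hik : i ≠ k) (hi : 𝒮 i i = 1) (hj : 𝒮 j j = 1) (hk : 𝒮 k k = -1)
    (h1 : cycle₂ 𝒮 i k = -1) (h2 : cycle₂ 𝒮 j k = 1) : HasBorderedSubpattern 𝒮 := by
  obtain ⟨σ, rfl, rfl, rfl⟩ := exists_perm_eq k i j hik.symm hij hjk.symm
  rw [cycle₂_comm, ← cycle₂_neg] at h1 h2
  apply HasBorderedSubpattern.of_neg
  apply HasBorderedSubpattern.of_perm σ
  exact hasBorderedSubpattern_of_star (by simp [hk]) (by simp [hi]) (by simp [hj]) h1 h2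

/-! ### Constraints on the cycle products of a spectrally arbitrary pattern -/

lemma exists_diag_signs (h : 𝒮.IsSpectrallyArbitrary) :
    (∃ i, 𝒮 i i = 1) ∧ ∃ k, 𝒮 k k = -1 := by
  rw [isSpectrallyArbitrary_iff] at h
  constructor
  · by_contra! hne
    obtain ⟨A, hA, ht, -⟩ := h 1 0 0
    have h0 : ∀ i, A i i ≤ 0 := fun i => by
      rw [← sign_nonpos_iff, hA i i, SignType.nonpos_iff_ne_one]; exact hne i
    rw [trace_fin_three] at ht
    linarith [h0 0, h0 1, h0 2]
  · by_contra! hne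
    obtain ⟨A, hA, ht, -⟩ := h (-1) 0 0
    have h0 : ∀ i, 0 ≤ A i i := fun i => by
      rw [← sign_nonneg_iff, hA i i, SignType.nonneg_iff_ne_neg_one]; exact hne i
    rw [trace_fin_three] at ht
    linarith [h0 0, h0 1, h0 2]

lemma sign_mul_eq_cycle₂ {A : Matrix (Fin 3) (Fin 3) ℝ} (hA : A ∈ 𝒮.Q) (i j : Fin 3) :
    SignType.sign (A i j * A j i) = cycle₂ 𝒮 i j := by
  rw [sign_mul, hA i j, hA j i, cycle₂]

lemma sign_mul_eq_cycle₃ {A : Matrix (Fin 3) (Fin 3) ℝ} (hA : A ∈ 𝒮.Q) (i j k : Fin 3) :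
    SignType.sign (A i j * A j k * A k i) = cycle₃ 𝒮 i j k := by
  rw [sign_mul, sign_mul, hA i j, hA j k, hA k i, cycle₃]

lemma nonneg_of_sign {x : ℝ} {s : SignType} (hx : SignType.sign x = s) (hs : s ≠ -1) : 0 ≤ x := by
  rwa [← sign_nonneg_iff, hx, SignType.nonneg_iff_ne_neg_one]

lemma nonpos_of_sign {x : ℝ} {s : SignType} (hx : SignType.sign x = s) (hs : s ≠ 1) : x ≤ 0 := by
  rwa [← sign_nonpos_iff, hx, SignType.nonpos_iff_ne_one]

lemma det_eq_cycles (A : Matrix (Fin 3) (Fin 3) ℝ) :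
    A.det = A 0 0 * A 1 1 * A 2 2 + A 0 1 * A 1 2 * A 2 0 + A 0 2 * A 2 1 * A 1 0
      - A 0 0 * (A 1 2 * A 2 1) - A 1 1 * (A 0 2 * A 2 0) - A 2 2 * (A 0 1 * A 1 0) := by
  rw [det_fin_three]
  ring

lemma exists_cycle₂_neg (h : 𝒮.IsSpectrallyArbitrary) (h0 : 𝒮 0 0 = 1) :
    cycle₂ 𝒮 0 1 = -1 ∨ cycle₂ 𝒮 1 2 = -1 ∨ cycle₂ 𝒮 0 2 = -1 := by
  obtain ⟨A, hA, ht, hs, -⟩ := isSpectrallyArbitrary_iff.mp h 0 0 0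
  by_contra! hne
  have h01 := nonneg_of_sign (sign_mul_eq_cycle₂ hA 0 1) hne.1
  have h12 := nonneg_of_sign (sign_mul_eq_cycle₂ hA 1 2) hne.2.1
  have h02 := nonneg_of_sign (sign_mul_eq_cycle₂ hA 0 2) hne.2.2
  have ha : 0 < A 0 0 := by rw [← sign_eq_one_iff, hA, h0]
  rw [trace_fin_three] at ht
  rw [minorSum] at hs
  -- The left-hand side below is the trace of `A ^ 2`.
  have htr : A 0 0 ^ 2 + A 1 1 ^ 2 + A 2 2 ^ 2
      + 2 * (A 0 1 * A 1 0 + A 1 2 * A 2 1 + A 0 2 * A 2 0) = 0 := by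
    linear_combination (A 0 0 + A 1 1 + A 2 2) * ht - 2 * hs
  nlinarith [pow_pos ha 2, sq_nonneg (A 1 1), sq_nonneg (A 2 2)]

/-- Some term of the determinant is positive. -/
lemma exists_det_term_pos (h : 𝒮.IsSpectrallyArbitrary) (h0 : 𝒮 0 0 = 1) (h1 : 𝒮 1 1 ≠ -1)
    (h2 : 𝒮 2 2 = -1) :
    cycle₃ 𝒮 0 1 2 = 1 ∨ cycle₃ 𝒮 0 2 1 = 1 ∨ cycle₂ 𝒮 0 1 = 1 ∨ cycle₂ 𝒮 1 2 = -1 ∨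
      (𝒮 1 1 = 1 ∧ cycle₂ 𝒮 0 2 = -1) := by
  obtain ⟨A, hA, -, -, hd⟩ := isSpectrallyArbitrary_iff.mp h 0 0 1
  by_contra! hne
  obtain ⟨hq, hr, h01, h12, h02⟩ := hne
  have hq := nonpos_of_sign (sign_mul_eq_cycle₃ hA 0 1 2) hq
  have hr := nonpos_of_sign (sign_mul_eq_cycle₃ hA 0 2 1) hr
  have h01 := nonpos_of_sign (sign_mul_eq_cycle₂ hA 0 1) h01
  have h12 := nonneg_of_sign (sign_mul_eq_cycle₂ hA 1 2) h12
  have ha : 0 < A 0 0 := by rw [← sign_eq_one_iff, hA, h0]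
  have hb : 0 ≤ A 1 1 := nonneg_of_sign (hA 1 1) h1
  have hc : A 2 2 < 0 := by rw [← sign_eq_neg_one_iff, hA, h2]
  have hb02 : 0 ≤ A 1 1 * (A 0 2 * A 2 0) := by
    rcases hb.eq_or_lt with hb | hb
    · simp [← hb]
    · have h11 : 𝒮 1 1 = 1 := by rw [← hA, sign_eq_one_iff]; exact hb
      exact mul_nonneg hb.le (nonneg_of_sign (sign_mul_eq_cycle₂ hA 0 2) (h02 h11))
  rw [det_eq_cycles] at hd
  have := mul_nonneg ha.le h12
  have := mul_nonneg_of_nonpos_of_nonpos hc.le h01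
  have := mul_nonpos_of_nonneg_of_nonpos (mul_nonneg ha.le hb) hc.le
  linarith

/-- Some term of the determinant is negative; if `𝒮 1 1 = 1` this holds for the diagonal term. -/
lemma exists_det_term_neg (h : 𝒮.IsSpectrallyArbitrary) (h0 : 𝒮 0 0 = 1) (h1 : 𝒮 1 1 = 0)
    (h2 : 𝒮 2 2 = -1) :
    cycle₃ 𝒮 0 1 2 = -1 ∨ cycle₃ 𝒮 0 2 1 = -1 ∨ cycle₂ 𝒮 0 1 = -1 ∨ cycle₂ 𝒮 1 2 = 1 := by
  obtain ⟨A, hA, -, -, hd⟩ := isSpectrallyArbitrary_iff.mp h 0 0 (-1)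
  by_contra! hne
  obtain ⟨hq, hr, h01, h12⟩ := hne
  have hq := nonneg_of_sign (sign_mul_eq_cycle₃ hA 0 1 2) hq
  have hr := nonneg_of_sign (sign_mul_eq_cycle₃ hA 0 2 1) hr
  have h01 := nonneg_of_sign (sign_mul_eq_cycle₂ hA 0 1) h01
  have h12 := nonpos_of_sign (sign_mul_eq_cycle₂ hA 1 2) h12
  have ha : 0 < A 0 0 := by rw [← sign_eq_one_iff, hA, h0]
  have hb : A 1 1 = 0 := by rw [← sign_eq_zero_iff, hA, h1]
  have hc : A 2 2 < 0 := by rw [← sign_eq_neg_one_iff, hA, h2]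
  rw [det_eq_cycles, hb] at hd
  have := mul_nonpos_of_nonneg_of_nonpos ha.le h12
  have := mul_nonpos_of_nonpos_of_nonneg hc.le h01
  linarith

/-- A nilpotent matrix with diagonal `a, b, -(a + b)`, where `a, b > 0`, cannot have all cycle
products of the signs given: vanishing of the second coefficient bounds the terms of the
determinant that compensate for the diagonal one from below by
`min a b * (a ^ 2 + a * b + b ^ 2)`, which exceeds `a * b * (a + b)`. Here `u`, `v`, `w` are the
`2`-cycles through `{0, 1}`, `{1, 2}`, `{0, 2}`, and `q`, `r` the `3`-cycles. -/
lemma false_of_cycle_signs {a b c u v w q r : ℝ} (ha : 0 < a) (hb : 0 < b) (hu : 0 ≤ u)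
    (hv : v ≤ 0) (hw : w ≤ 0) (hq : 0 ≤ q) (hr : 0 ≤ r) (htr : a + b + c = 0)
    (hminor : a * b - u + (a * c - w) + (b * c - v) = 0)
    (hdet : a * b * c + q + r - a * v - b * w - c * u = 0) : False := by
  obtain rfl : c = -(a + b) := by linarith
  have hvw : -v - w = a ^ 2 + a * b + b ^ 2 + u := by linarith
  have hu' : 0 ≤ (a + b) * u := by positivity
  rcases le_total a b with hab | hab
  · have h1 : 0 ≤ (b - a) * -w := mul_nonneg (by linarith) (by linarith)
    have h2 : a * (-v - w) = a * (a ^ 2 + a * b + b ^ 2 + u) := by rw [hvw]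
    have h3 : 0 < a ^ 3 := by positivity
    have h4 : 0 ≤ a * u := by positivity
    nlinarith
  · have h1 : 0 ≤ (a - b) * -v := mul_nonneg (by linarith) (by linarith)
    have h2 : b * (-v - w) = b * (a ^ 2 + a * b + b ^ 2 + u) := by rw [hvw]
    have h3 : 0 < b ^ 3 := by positivity
    have h4 : 0 ≤ b * u := by positivity
    nlinarith

/-- For the diagonal `(+, +, -)` the cycle products avoid the signs of `false_of_cycle_signs`, since
`𝒮` has a nilpotent realization. -/
lemma exists_cycle_sign_ne (h : 𝒮.IsSpectrallyArbitrary) (h0 : 𝒮 0 0 = 1) (h1 : 𝒮 1 1 = 1) :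
    cycle₂ 𝒮 0 1 = -1 ∨ cycle₂ 𝒮 1 2 = 1 ∨ cycle₂ 𝒮 0 2 = 1 ∨
      cycle₃ 𝒮 0 1 2 = -1 ∨ cycle₃ 𝒮 0 2 1 = -1 := by
  obtain ⟨A, hA, ht, hs, hd⟩ := isSpectrallyArbitrary_iff.mp h 0 0 0
  by_contra! hne
  obtain ⟨h01, h12, h02, hq, hr⟩ := hne
  have ha : 0 < A 0 0 := by rw [← sign_eq_one_iff, hA, h0]
  have hb : 0 < A 1 1 := by rw [← sign_eq_one_iff, hA, h1]
  rw [trace_fin_three] at ht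
  rw [minorSum] at hs
  rw [det_eq_cycles] at hd
  exact false_of_cycle_signs ha hb (nonneg_of_sign (sign_mul_eq_cycle₂ hA 0 1) h01)
    (nonpos_of_sign (sign_mul_eq_cycle₂ hA 1 2) h12)
    (nonpos_of_sign (sign_mul_eq_cycle₂ hA 0 2) h02)
    (nonneg_of_sign (sign_mul_eq_cycle₃ hA 0 1 2) hq)
    (nonneg_of_sign (sign_mul_eq_cycle₃ hA 0 2 1) hr) ht hs hd

/-! ### The finite check -/

lemma cycle_signs_of_zero : ∀ u v w q r : SignType, q * r = u * v * w ∧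
    (u = -1 ∨ v = -1 ∨ w = -1) ∧ (q = 1 ∨ r = 1 ∨ u = 1 ∨ v = -1) ∧
    (q = -1 ∨ r = -1 ∨ u = -1 ∨ v = 1) → IsForcingUpToSymmetry u v w q r := by
  decide

lemma cycle_signs_of_pos : ∀ u v w q r : SignType, q * r = u * v * w ∧
    (u = -1 ∨ v = -1 ∨ w = -1) ∧ (q = 1 ∨ r = 1 ∨ u = 1 ∨ v = -1 ∨ w = -1) ∧
    (u = -1 ∨ v = 1 ∨ w = 1 ∨ q = -1 ∨ r = -1) →
    IsForcingUpToSymmetry u v w q r ∨ IsForcingUpToSymmetry u w v r q ∨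
      (w = -1 ∧ v = 1) ∨ (v = -1 ∧ w = 1) := by
  decide

lemma hasBorderedSubpattern_of_diag (h : 𝒮.IsSpectrallyArbitrary) (h0 : 𝒮 0 0 = 1)
    (h1 : 𝒮 1 1 ≠ -1) (h2 : 𝒮 2 2 = -1) : HasBorderedSubpattern 𝒮 := by
  have hqr := cycle₃_mul_cycle₃ (𝒮 := 𝒮) 0 1 2
  have hneg := exists_cycle₂_neg h h0
  have hpos := exists_det_term_pos h h0 h1 h2
  rcases SignType.trichotomy (𝒮 1 1) with h11 | h11 | h11
  · exact absurd h11 h1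
  · refine hasBorderedSubpattern_of_cycles (i := 0) (j := 1) (k := 2) (by decide) (by decide)
      (by decide) h0 h2 (cycle_signs_of_zero _ _ _ _ _ ⟨hqr, hneg, ?_, exists_det_term_neg h h0 h11 h2⟩)
    simpa [h11] using hpos
  · rcases cycle_signs_of_pos _ _ _ _ _ ⟨hqr, hneg, by simpa [h11] using hpos,
      exists_cycle_sign_ne h h0 h11⟩ with hf | hf | ⟨hw, hv⟩ | ⟨hv, hw⟩
    · exact hasBorderedSubpattern_of_cycles (by decide) (by decide) (by decide) h0 h2 hf
    · rw [cycle₂_comm 0 1, cycle₃_rotate 0 1 2, ← cycle₃_rotate 1 0 2] at hf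
      exact hasBorderedSubpattern_of_cycles (by decide) (by decide) (by decide) h11 h2 hf
    · exact hasBorderedSubpattern_of_neg_star (by decide) (by decide) (by decide) h0 h11 h2 hw hv
    · exact hasBorderedSubpattern_of_neg_star (by decide) (by decide) (by decide) h11 h0 h2 hv hw

lemma exists_third : ∀ i k : Fin 3, i ≠ k → ∃ j, i ≠ j ∧ j ≠ k := by decide

end SignPattern

/-- Every spectrally arbitrary sign pattern of order 3 is, up to equivalence, a superpattern of a
spectrally arbitrary pattern obtained from `𝒯₂` by bordering. -/
theorem corollary4p1 (𝒮 : SignPattern 3) (h𝒮 : SignPattern.IsSpectrallyArbitrary 𝒮) :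
    ∃ ℬ ℬ' : SignPattern 3,
      SignPattern.IsBorderingOf ℬ SignPattern.T₂ ∧
      SignPattern.IsSpectrallyArbitrary ℬ ∧
      SignPattern.Equivalent ℬ ℬ' ∧
      SignPattern.IsSuperpattern 𝒮 ℬ' := by
  obtain ⟨⟨i, hi⟩, k, hk⟩ := SignPattern.exists_diag_signs h𝒮
  have hik : i ≠ k := by
    rintro rfl
    simp [hi] at hk
  obtain ⟨j, hij, hjk⟩ := SignPattern.exists_third i k hik
  by_cases hj : 𝒮 j j = -1
  · -- Negation exchanges the signs: `-𝒮` has diagonal `(+, +, -)` at `k, j, i`.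
    obtain ⟨σ, rfl, rfl, rfl⟩ := SignPattern.exists_perm_eq k j i hjk.symm hij.symm hik.symm
    apply SignPattern.HasBorderedSubpattern.of_neg
    apply SignPattern.HasBorderedSubpattern.of_perm σ
    exact SignPattern.hasBorderedSubpattern_of_diag (h𝒮.neg.perm σ) (by simp [hk]) (by simp [hj])
      (by simp [hi])
  · obtain ⟨σ, rfl, rfl, rfl⟩ := SignPattern.exists_perm_eq i j k hij hjk hik
    apply SignPattern.HasBorderedSubpattern.of_perm σ
    exact SignPattern.hasBorderedSubpattern_of_diag (h𝒮.perm σ) hi hj hk
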